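/- Let $m,n\ge 0$ and let $$P=\begin{pmatrix}P_4&P_3\\P_2&P_1\end{pmatrix}\in GL_{m+n}(\mathbb F_2),\qquad P_4\in\mathbb F_2^{m\times m},\quad P_1\in\mathbb F_2^{n\times n},$$ and put $p_i=\operatorname{rank}P_i$. Let $\pi(P)$ be the permutation of $\{0,\dots,2^{m+n}-1\}$ that maps $i$ to the $j$ with $j_b=P\,i_b$, where $i_b\in\mathbb F_2^{m+n}$ is the vector of binary digits of $i$, most significant digit on top. The streaming linear permutation (SLP) given by $P$ performs $\pi(P)$ on datasets of $2^{m+n}$ words that are streamed through $2^n$ ports during $2^m$ clock cycles: the word with index $i=c\cdot 2^n+p$ ($0\le c<2^m$, $0\le p<2^n$) enters in cycle $c$ of its dataset on port $p$, and has to leave, with a fixed latency, in cycle $c'$ on port $p'$, where $\pi(P)(i)=c'\cdot 2^n+p'$. Datasets follow each other without gap, both at the input and at the output. A *switching network* on $2^n$ lines is a memoryless circuit composed of fixed wirings (permutations of the lines) and $2\times2$-switches; a switch sits on two different lines and, depending on a control bit that is a function of the cycle $c$ within the dataset, passes its two words straight or exchanges them. A *RAM bank array* consists of $2^n$ RAM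 banks, one per port, with $2\cdot 2^m$ words each (double buffering); in every clock cycle each bank outputs the word at its current read address and stores the incoming word at its current write address, the two addresses being functions of the clock cycle modulo $2\cdot2^m$. **Theorem.** The SLP given by $P$ can be implemented by a RAM bank array framed by two switching networks (one before it and one after it) that use a total of exactly $$\max(p_2,\;n+m-p_1-p_4)\cdot 2^{n-1}$$ $2\times 2$-switches. (For $n=0$ the maximum, and hence the number of switches, is $0$.) -/

import Mathlib

open Matrix

namespace SLP

/-! ### Linear permutations -/

/-- The radix-2 digits of `i < 2 ^ k` as a vector over `𝔽₂`, most significant digit on top. -/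
def bitVec (k : ℕ) : Fin (2 ^ k) ≃ (Fin k → ZMod 2) :=
  (finFunctionFinEquiv.symm.trans (Equiv.arrowCongr Fin.revPerm (ZMod.finEquiv 2).toEquiv))

theorem bitVec_apply (k : ℕ) (i : Fin (2 ^ k)) (j : Fin k) :
    bitVec k i j = (((i : ℕ) / 2 ^ (k - 1 - (j : ℕ)) : ℕ) : ZMod 2) := by
  have h : k - ((j : ℕ) + 1) = k - 1 - (j : ℕ) := by omega
  have key : ∀ a : Fin 2, ZMod.finEquiv 2 a = ((a : ℕ) : ZMod 2) := by decide
  simp [bitVec, Equiv.arrowCongr, key, Fin.val_rev, h]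

/-- The permutation of `𝔽₂ᵏ` given by multiplication by `P`. -/
def mulVecPerm {k : ℕ} (P : GL (Fin k) (ZMod 2)) : Equiv.Perm (Fin k → ZMod 2) where
  toFun v := (P : Matrix (Fin k) (Fin k) (ZMod 2)) *ᵥ v
  invFun v := ((P⁻¹ : GL (Fin k) (ZMod 2)) : Matrix (Fin k) (Fin k) (ZMod 2)) *ᵥ v
  left_inv v := by
    beta_reduce
    rw [Matrix.mulVec_mulVec, ← Units.val_mul, inv_mul_cancel, Units.val_one, Matrix.one_mulVec]
  right_inv v := by
    beta_reduce
    rw [Matrix.mulVec_mulVec, ← Units.val_mul, mul_inv_cancel, Units.val_one, Matrix.one_mulVec]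

/-- The linear permutation `π(P)` of `{0, …, 2 ^ k - 1}`: it maps `i` to the `j` whose
digit vector is `P` times the digit vector of `i`. -/
def linearPerm {k : ℕ} (P : GL (Fin k) (ZMod 2)) : Equiv.Perm (Fin (2 ^ k)) :=
  (bitVec k).trans ((mulVecPerm P).trans (bitVec k).symm)

theorem bitVec_linearPerm {k : ℕ} (P : GL (Fin k) (ZMod 2)) (i : Fin (2 ^ k)) :
    bitVec k (linearPerm P i) = (P : Matrix (Fin k) (Fin k) (ZMod 2)) *ᵥ bitVec k i := by
  simp [linearPerm, mulVecPerm]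

/-! ### The blocks of `P = (P₄ P₃; P₂ P₁)`, where `P₄` is `m × m` and `P₁` is `n × n` -/

section Blocks

variable {m n : ℕ}

def block₄ (P : GL (Fin (m + n)) (ZMod 2)) : Matrix (Fin m) (Fin m) (ZMod 2) :=
  (P : Matrix (Fin (m + n)) (Fin (m + n)) (ZMod 2)).submatrix (Fin.castAdd n) (Fin.castAdd n)

def block₂ (P : GL (Fin (m + n)) (ZMod 2)) : Matrix (Fin n) (Fin m) (ZMod 2) :=
  (P : Matrix (Fin (m + n)) (Fin (m + n)) (ZMod 2)).submatrix (Fin.natAdd m) (Fin.castAdd n)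

def block₁ (P : GL (Fin (m + n)) (ZMod 2)) : Matrix (Fin n) (Fin n) (ZMod 2) :=
  (P : Matrix (Fin (m + n)) (Fin (m + n)) (ZMod 2)).submatrix (Fin.natAdd m) (Fin.natAdd m)

end Blocks

/-! ### Streams -/

/-- What a bundle of `2 ^ n` ports carries: one word of `α` per clock cycle and per port. -/
abbrev Stream (n : ℕ) (α : Type) : Type := ℕ → Fin (2 ^ n) → α

/-- The value at clock cycle `t` of a cyclic counter with `2 ^ k` states. -/
def counter (k t : ℕ) : Fin (2 ^ k) := ⟨t % 2 ^ k, Nat.mod_lt _ (Nat.two_pow_pos k)⟩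

/-- The element `i = c * 2 ^ n + p` of a dataset is transferred in cycle `c` of the dataset ... -/
def cycleOf {m n : ℕ} (i : Fin (2 ^ (m + n))) : ℕ := (i : ℕ) / 2 ^ n

/-- ... on port `p`. -/
def portOf {m n : ℕ} (i : Fin (2 ^ (m + n))) : Fin (2 ^ n) :=
  ⟨(i : ℕ) % 2 ^ n, Nat.mod_lt _ (Nat.two_pow_pos n)⟩

/-! ### Switching networks -/

/-- The components of a switching network on `2 ^ n` lines: fixed wirings, and `2 × 2`-switches.
A switch sits on two different lines; in each cycle it either passes its two words straight or
exchanges them, as told by a control bit that depends on the cycle `c` within the dataset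
(`0 ≤ c < 2 ^ m`) only. -/
inductive Component (m n : ℕ) : Type
  | wiring (σ : Equiv.Perm (Fin (2 ^ n))) : Component m n
  | switch (a b : Fin (2 ^ n)) (hab : a ≠ b) (control : Fin (2 ^ m) → Bool) : Component m n

namespace Component

variable {m n : ℕ}

/-- The permutation of the lines that a component performs in cycle `c`: the word on
line `q` moves to line `perm c q`. -/
def perm : Component m n → Fin (2 ^ m) → Equiv.Perm (Fin (2 ^ n))
  | wiring σ, _ => σ
  | switch a b _ control, c => if control c then Equiv.swap a b else 1

/-- The number of switches in a component. -/
def switchCount : Component m n → ℕ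
  | wiring _ => 0
  | switch _ _ _ _ => 1

end Component

/-- A switching network: components traversed one after the other, head first. -/
abbrev SwitchingNetwork (m n : ℕ) : Type := List (Component m n)

namespace SwitchingNetwork

variable {m n : ℕ}

/-- The permutation of the lines that the network performs in cycle `c`. -/
def perm : SwitchingNetwork m n → Fin (2 ^ m) → Equiv.Perm (Fin (2 ^ n))
  | [], _ => 1
  | X :: N, c => perm N c * X.perm c

/-- The total number of `2 × 2`-switches of the network. -/
def switchCount (N : SwitchingNetwork m n) : ℕ := (N.map Component.switchCount).sum

/-- A switching network has no memory: in each clock cycle it permutes the words on its lines. -/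
def run {α : Type} (N : SwitchingNetwork m n) (s : Stream n α) : Stream n α :=
  fun t q => s t ((perm N (counter m t)).symm q)

end SwitchingNetwork

/-! ### RAM bank arrays -/

/-- An array of `2 ^ n` RAM banks, one for each port. A bank has `2 * 2 ^ m` words (double
buffering); its write and read addresses are driven by a counter with `2 * 2 ^ m` states. -/
structure RAMBankArray (m n : ℕ) : Type where
  writeAddr : Fin (2 ^ n) → Fin (2 ^ (m + 1)) → Fin (2 ^ (m + 1))
  readAddr : Fin (2 ^ n) → Fin (2 ^ (m + 1)) → Fin (2 ^ (m + 1))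

namespace RAMBankArray

variable {m n : ℕ} {α : Type}

/-- The contents of bank `p` at the beginning of each clock cycle: in every clock cycle the word
arriving on port `p` is stored at the current write address. -/
def contents (B : RAMBankArray m n) (init : Fin (2 ^ n) → Fin (2 ^ (m + 1)) → α) (s : Stream n α)
    (p : Fin (2 ^ n)) : ℕ → Fin (2 ^ (m + 1)) → α
  | 0 => init p
  | t + 1 => Function.update (contents B init s p t) (B.writeAddr p (counter (m + 1) t)) (s t p)

/-- In every clock cycle, bank `p` outputs on port `p` the word stored at the read address. -/
def run (B : RAMBankArray m n) (init : Fin (2 ^ n) → Fin (2 ^ (m + 1)) → α) (s : Stream n α) :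
    Stream n α :=
  fun t p => B.contents init s p t (B.readAddr p (counter (m + 1) t))

end RAMBankArray

/-! ### A RAM bank array framed by two switching networks -/

structure FramedCircuit (m n : ℕ) : Type where
  inputNetwork : SwitchingNetwork m n
  banks : RAMBankArray m n
  outputNetwork : SwitchingNetwork m n

namespace FramedCircuit

variable {m n : ℕ}

def run {α : Type} (C : FramedCircuit m n) (init : Fin (2 ^ n) → Fin (2 ^ (m + 1)) → α)
    (s : Stream n α) : Stream n α :=
  SwitchingNetwork.run C.outputNetwork (C.banks.run init (SwitchingNetwork.run C.inputNetwork s))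

/-- The number of `2 × 2`-switches of the two switching networks together. -/
def switchCount (C : FramedCircuit m n) : ℕ :=
  SwitchingNetwork.switchCount C.inputNetwork + SwitchingNetwork.switchCount C.outputNetwork

/-- The circuit implements the streaming permutation `σ` of `2 ^ (m + n)` elements on `2 ^ n`
ports. Datasets arrive back to back, dataset `d` in the clock cycles
`d * 2 ^ m, …, (d + 1) * 2 ^ m - 1`; after a fixed latency, the permuted datasets leave in the same
fashion, where the element with index `i` has the index `σ i`. This holds for words of
any type and whatever the initial contents of the banks. -/
def Implements (C : FramedCircuit m n) (σ : Equiv.Perm (Fin (2 ^ (m + n)))) : Prop :=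
  ∃ latency : ℕ, ∀ (α : Type) (init : Fin (2 ^ n) → Fin (2 ^ (m + 1)) → α) (s : Stream n α)
    (d : ℕ) (i : Fin (2 ^ (m + n))),
    C.run init s (latency + d * 2 ^ m + cycleOf (σ i)) (portOf (σ i)) =
      s (d * 2 ^ m + cycleOf i) (portOf i)

end FramedCircuit

end SLP

/-! Write an index as a pair (c, p) in E × F of cycle and port, E = 𝔽₂ᵐ and F = 𝔽₂ⁿ, and let T be
multiplication by P. A linear shear p ↦ p + X c costs rank X · 2^(n-1) switches: it is a composition
of rank X conditional translations, each pairing up the lines. A map that fixes the line and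
permutes the cycles on each line is the work of the banks, and an automorphism of F is a wiring,
free of charge. So T is to be factored as shear X, banks, wiring, shear L, with rank X + rank L
equal to the stated maximum.

This is a question about subspaces. Put U = E × 0, W = 0 × F, U' = T⁻¹U, W' = T⁻¹W. The graph Γ of X
is a complement of W; the factorization exists once Γ is also a complement of W', and then T maps Γ
onto the graph of L. Moreover rank X = m - dim(Γ ∩ U) and rank L = m - dim(Γ ∩ U'), so a common
complement with prescribed, in fact maximal, dim(Γ ∩ U) + dim(Γ ∩ U') is needed. The dimensions m -
p₂, m - p₄, n - p₁ of U ∩ U', U ∩ W', U' ∩ W give two upper bounds for this sum, and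
`exists_commonComplement` attains the smaller one. `exists_factorization` translates back to
matrices, and `implements_of_forall` to circuits. -/

namespace SLP

/-! ### Common complements in a pair of direct sum decompositions. -/

section CommonComplement

open Module Submodule

variable {K V : Type*} [Field K] [AddCommGroup V] [Module K V]

/-- No vector space is the union of two proper subspaces. This holds over every field; for three
subspaces it fails over 𝔽₂, so later constructions avoid at most two subspaces at a time. -/
theorem exists_mem_notMem_notMem {A B U : Submodule K V} (hA : ¬ U ≤ A) (hB : ¬ U ≤ B) :
    ∃ v ∈ U, v ∉ A ∧ v ∉ B := by
  obtain ⟨x, hxU, hxA⟩ := SetLike.not_le_iff_exists.1 hA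
  obtain ⟨y, hyU, hyB⟩ := SetLike.not_le_iff_exists.1 hB
  by_cases hxB : x ∈ B
  · by_cases hyA : y ∈ A
    · exact ⟨x + y, U.add_mem hxU hyU, fun h => hxA ((A.add_mem_iff_left hyA).1 h),
        fun h => hyB ((B.add_mem_iff_right hxB).1 h)⟩
    · exact ⟨y, hyU, hyA, hyB⟩
  · exact ⟨x, hxU, hxA, hxB⟩

/-- If s + s' lies in W, then s lies in W + U', hence in U ∩ U' and so in S'. Thus s + s' itself
lies in S' ∩ W, which is trivial. -/
theorem disjoint_sup_of_inf_le {U W U' S S' : Submodule K V} (hKS' : U ⊓ U' ≤ S') (hS'U' : S' ≤ U')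
    (hS' : Disjoint S' (U' ⊓ W)) (hS : S ⊓ (W ⊔ U') ≤ U ⊓ U') : Disjoint (S ⊔ S') W := by
  refine disjoint_def.2 fun x hx hxW => ?_
  obtain ⟨s, hs, s', hs', rfl⟩ := mem_sup.1 hx
  have hsK : s ∈ U ⊓ U' := hS ⟨hs, by
    have : s = (s + s') + -s' := by abel
    rw [this]
    exact add_mem_sup hxW (neg_mem (hS'U' hs'))⟩
  have hmem : s + s' ∈ S' := S'.add_mem (hKS' hsK) hs'
  exact disjoint_def.1 hS' _ hmem ⟨hS'U' hmem, hxW⟩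

variable [FiniteDimensional K V]

theorem finrank_sup_of_disjoint {A B : Submodule K V} (h : Disjoint A B) :
    finrank K ↥(A ⊔ B) = finrank K A + finrank K B := by
  have := finrank_sup_add_finrank_inf_eq A B
  rwa [h.eq_bot, finrank_bot, add_zero] at this

/-- A subspace `S` of `U` that meets neither `A` nor `B`, where `dim B ≤ dim A`, extends to a
complement of `A` in `U` that does not meet `B`. -/
theorem exists_complement_disjoint {A B S U : Submodule K V} (hAU : A ≤ U) (hSU : S ≤ U)
    (hSA : Disjoint S A) (hSB : Disjoint S B) (hd : finrank K B ≤ finrank K A) :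
    ∃ C, S ≤ C ∧ C ≤ U ∧ Disjoint C A ∧ Disjoint C B ∧ C ⊔ A = U := by
  -- Take C maximal. If C + A were not all of U, a vector of U outside both C + A and C + B would
  -- enlarge C.
  obtain ⟨C, ⟨hSC, hCU, hCA, hCB⟩, hmax⟩ := (wellFounded_gt (α := Submodule K V)).has_min
    {C | S ≤ C ∧ C ≤ U ∧ Disjoint C A ∧ Disjoint C B} ⟨S, le_rfl, hSU, hSA, hSB⟩
  refine ⟨C, hSC, hCU, hCA, hCB, ?_⟩
  by_contra hne
  have hle : C ⊔ A ≤ U := sup_le hCU hAU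
  have hA : ¬ U ≤ C ⊔ A := fun h => hne (le_antisymm hle h)
  -- Since dim B ≤ dim A, C + B cannot fill U before C + A does.
  have hB : ¬ U ≤ C ⊔ B := fun h => hne <| eq_of_le_of_finrank_le hle <| by
    have := finrank_mono h
    rw [finrank_sup_of_disjoint hCB] at this
    rw [finrank_sup_of_disjoint hCA]
    omega
  obtain ⟨v, hvU, hvA, hvB⟩ := exists_mem_notMem_notMem hA hB
  have extend : ∀ D : Submodule K V, Disjoint C D → v ∉ C ⊔ D → Disjoint (C ⊔ span K {v}) D := by
    intro D hCD hv
    refine (Disjoint.disjoint_sup_right_of_disjoint_sup_left hCD.symm ?_).symm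
    rw [sup_comm, disjoint_span_singleton]
    exact fun h => absurd h hv
  refine hmax (C ⊔ span K {v}) ⟨hSC.trans le_sup_left, sup_le hCU (by simpa using hvU),
    extend A hCA hvA, extend B hCB hvB⟩ (lt_of_le_of_ne le_sup_left fun h => hvA ?_)
  exact mem_sup_left (h ▸ mem_sup_right (mem_span_singleton_self v))

variable {U W U' W' : Submodule K V}

/-- Rank–nullity for the projection onto U along W, restricted to T: its image is U ∩ (W + T) and
its kernel is T ∩ W. -/
theorem finrank_inf_sup_add (h : IsCompl U W) (T : Submodule K V) :
    finrank K ↥(U ⊓ (W ⊔ T)) + finrank K ↥(T ⊓ W) = finrank K T := by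
  have h1 := finrank_sup_add_finrank_inf_eq U (W ⊔ T)
  have h2 := finrank_sup_add_finrank_inf_eq T W
  have h3 := finrank_sup_of_disjoint h.disjoint
  have h4 : U ⊔ (W ⊔ T) = U ⊔ W := by rw [h.sup_eq_top, ← sup_assoc, h.sup_eq_top, top_sup_eq]
  rw [h4] at h1
  rw [sup_comm] at h2
  omega

theorem finrank_eq_of_isCompl (h : IsCompl U W) (h' : IsCompl U' W')
    (hd : finrank K U = finrank K U') : finrank K W = finrank K W' := by
  have := finrank_add_eq_of_isCompl h
  have := finrank_add_eq_of_isCompl h'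
  omega

theorem isCompl_of_sup_eq_top {A W U : Submodule K V} (h : IsCompl U W)
    (hd : finrank K A ≤ finrank K U) (ht : A ⊔ W = ⊤) : IsCompl A W := by
  have h1 := finrank_sup_add_finrank_inf_eq A W
  have h2 := finrank_add_eq_of_isCompl h
  rw [ht, finrank_top] at h1
  refine ⟨disjoint_iff.2 (finrank_eq_zero.1 ?_), codisjoint_iff.2 ht⟩
  omega

/-- Γ = S + S', where S complements U ∩ (W + U') in U, and S' contains U ∩ U' and complements U' ∩ W
in U'. Then dim S = dim(U' ∩ W), so dim S + dim S' = dim U, and it suffices that Γ + W and Γ + W'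
are everything. The extra avoidance conditions on S and S' provide the latter. -/
theorem exists_commonComplement_of_le (h : IsCompl U W) (h' : IsCompl U' W')
    (hd : finrank K U = finrank K U')
    (hle : finrank K ↥(U ⊓ W') + finrank K ↥(U' ⊓ W) + finrank K ↥(U ⊓ U') ≤ finrank K U) :
    ∃ Γ, IsCompl Γ W ∧ IsCompl Γ W' ∧
      finrank K U + finrank K ↥(U ⊓ U') ≤ finrank K ↥(Γ ⊓ U) + finrank K ↥(Γ ⊓ U') := by
  have hF := finrank_inf_sup_add h U'
  -- This is where the case assumption enters: S can be made to avoid (U ∩ W') + (U ∩ U') as well.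
  have hEK : finrank K ↥(U ⊓ W' ⊔ U ⊓ U') ≤ finrank K ↥(U ⊓ (W ⊔ U')) := by
    have := finrank_add_le_finrank_add_finrank (U ⊓ W') (U ⊓ U')
    omega
  obtain ⟨S, -, hSU, hSF, hSEK, hS⟩ := exists_complement_disjoint (S := ⊥) (U := U)
    (A := U ⊓ (W ⊔ U')) inf_le_left bot_le disjoint_bot_left disjoint_bot_left hEK
  have hSd := finrank_sup_of_disjoint hSF
  rw [hS] at hSd
  have hSW' : S ⊓ W' = ⊥ := by
    rw [eq_bot_iff]
    intro x hx
    exact (disjoint_def.1 hSEK x hx.1 (mem_sup_left ⟨hSU hx.1, hx.2⟩))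
  have hG := finrank_inf_sup_add h' S
  rw [hSW', finrank_bot] at hG
  have hKB : Disjoint (U ⊓ U') (U' ⊓ W) :=
    disjoint_def.2 fun x hx hy => disjoint_def.1 h.disjoint x hx.1 hy.2
  -- If x in U ∩ U' is w + s with w in W' and s in S, then w lies in U ∩ W', so s lies in (U ∩ W') +
  -- (U ∩ U'), which S avoids.
  have hKG : Disjoint (U ⊓ U') (U' ⊓ (W' ⊔ S)) := by
    refine disjoint_def.2 fun x hx hy => ?_
    obtain ⟨w, hw, s, hs, rfl⟩ := mem_sup.1 hy.2
    have hwU : w ∈ U := (U.add_mem_iff_left (hSU hs)).1 hx.1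
    have hs0 : s = 0 := by
      refine disjoint_def.1 hSEK s hs ?_
      have : s = -w + (w + s) := by abel
      rw [this]
      exact add_mem_sup (neg_mem ⟨hwU, hw⟩) hx
    subst hs0
    rw [add_zero] at hx ⊢
    exact disjoint_def.1 h'.disjoint w hx.2 hw
  -- Both avoided subspaces have dimension dim S, so S' complements each of them in U'; one gives Γ
  -- + W = V, the other Γ + W' = V.
  obtain ⟨S', hKS', hS'U', hS'B, hS'G, hS'⟩ := exists_complement_disjoint (S := U ⊓ U') (U := U')
    (A := U' ⊓ W) (B := U' ⊓ (W' ⊔ S)) inf_le_left inf_le_right hKB hKG (by omega)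
  have hS'd := finrank_sup_of_disjoint hS'B
  rw [hS'] at hS'd
  have hS'G' : S' ⊔ U' ⊓ (W' ⊔ S) = U' := by
    refine eq_of_le_of_finrank_le (sup_le hS'U' inf_le_left) ?_
    rw [finrank_sup_of_disjoint hS'G]
    omega
  have hΓ : finrank K ↥(S ⊔ S') ≤ finrank K U := by
    have := finrank_add_le_finrank_add_finrank S S'
    omega
  have hSK : Disjoint S (U ⊓ U') := hSEK.mono_right le_sup_right
  have hSKd := finrank_sup_of_disjoint hSK
  have h1 : finrank K ↥(S ⊔ U ⊓ U') ≤ finrank K ↥((S ⊔ S') ⊓ U) :=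
    finrank_mono (le_inf (sup_le_sup_left hKS' S) (sup_le hSU inf_le_left))
  have h2 : finrank K S' ≤ finrank K ↥((S ⊔ S') ⊓ U') := finrank_mono (le_inf le_sup_right hS'U')
  refine ⟨S ⊔ S', isCompl_of_sup_eq_top h hΓ ?_, isCompl_of_sup_eq_top h' (hΓ.trans hd.le) ?_,
    by omega⟩
  · have hU' : U' ≤ S ⊔ S' ⊔ W :=
      hS'.ge.trans (sup_le (le_sup_right.trans le_sup_left) (inf_le_right.trans le_sup_right))
    have hU : U ≤ S ⊔ S' ⊔ W := hS.ge.trans (sup_le (le_sup_left.trans le_sup_left)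
      (inf_le_right.trans (sup_le le_sup_right hU')))
    exact eq_top_iff.2 (h.sup_eq_top.ge.trans (sup_le hU le_sup_right))
  · have hU' : U' ≤ S ⊔ S' ⊔ W' := hS'G'.ge.trans (sup_le (le_sup_right.trans le_sup_left)
      (inf_le_right.trans (sup_le le_sup_right (le_sup_left.trans le_sup_left))))
    exact eq_top_iff.2 (h'.sup_eq_top.ge.trans (sup_le hU' le_sup_right))

/-- Let F be a complement of U ∩ U' in U ∩ (W + U'). The case assumption says dim F ≤ dim(U ∩ W'),
so the complement S of U ∩ W' can also avoid F. As S contains U ∩ U', it meets U ∩ (W + U') in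
nothing more. -/
theorem exists_large_complement (h : IsCompl U W) (h' : IsCompl U' W')
    (hle : finrank K U' ≤
      finrank K ↥(U ⊓ W') + finrank K ↥(U' ⊓ W) + finrank K ↥(U ⊓ U')) :
    ∃ S, U ⊓ U' ≤ S ∧ S ≤ U ∧ Disjoint S (U ⊓ W') ∧ S ⊔ U ⊓ W' = U ∧
      S ⊓ (W ⊔ U') ≤ U ⊓ U' := by
  have hF := finrank_inf_sup_add h U'
  obtain ⟨F, -, -, hFK, -, hFs⟩ := exists_complement_disjoint (S := ⊥) (A := U ⊓ U') (B := ⊥)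
    (U := U ⊓ (W ⊔ U')) (inf_le_inf_left _ le_sup_right) bot_le disjoint_bot_left
    disjoint_bot_left (by simp)
  have hFd := finrank_sup_of_disjoint hFK
  rw [hFs] at hFd
  have hKE : Disjoint (U ⊓ U') (U ⊓ W') :=
    disjoint_def.2 fun x hx hy => disjoint_def.1 h'.disjoint x hx.2 hy.2
  obtain ⟨S, hKS, hSU, hSE, hSF, hS⟩ := exists_complement_disjoint (U := U) inf_le_left
    inf_le_left hKE hFK.symm (by omega)
  refine ⟨S, hKS, hSU, hSE, hS, fun x hx => ?_⟩
  have hxF : x ∈ U ⊓ (W ⊔ U') := ⟨hSU hx.1, hx.2⟩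
  rw [← hFs] at hxF
  obtain ⟨f, hf, k, hk, rfl⟩ := mem_sup.1 hxF
  have : f = 0 := disjoint_def.1 hSF f ((S.add_mem_iff_left (hKS hk)).1 hx.1) hf
  simpa [this] using hk

/-- Here S and S' are as large as W' and W permit in U and U'. Their sum meets neither W nor W' and
so extends to a common complement, since dim W = dim W'. -/
theorem exists_commonComplement_of_ge (h : IsCompl U W) (h' : IsCompl U' W')
    (hd : finrank K U = finrank K U')
    (hle : finrank K U ≤ finrank K ↥(U ⊓ W') + finrank K ↥(U' ⊓ W) + finrank K ↥(U ⊓ U')) :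
    ∃ Γ, IsCompl Γ W ∧ IsCompl Γ W' ∧
      2 * finrank K U ≤ finrank K ↥(Γ ⊓ U) + finrank K ↥(Γ ⊓ U') +
        (finrank K ↥(U ⊓ W') + finrank K ↥(U' ⊓ W)) := by
  obtain ⟨S, hKS, hSU, hSE, hS, hSF⟩ := exists_large_complement h h' (hd ▸ hle)
  obtain ⟨S', hKS', hS'U', hS'E, hS', hS'F⟩ := exists_large_complement h' h
    (by rw [inf_comm U' U]; omega)
  rw [inf_comm U' U] at hKS' hS'F
  have hW := disjoint_sup_of_inf_le hKS' hS'U' hS'E hSF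
  have hW' : Disjoint (S ⊔ S') W' := by
    rw [sup_comm]
    rw [inf_comm U U'] at hKS hS'F
    exact disjoint_sup_of_inf_le hKS hSU hSE hS'F
  have hWd := finrank_eq_of_isCompl h h' hd
  obtain ⟨Γ, hle, -, hΓW, hΓW', ht⟩ := exists_complement_disjoint (U := ⊤) le_top le_top hW hW'
    hWd.ge
  have hΓ : IsCompl Γ W := ⟨hΓW, codisjoint_iff.2 ht⟩
  have hΓ' : IsCompl Γ W' := by
    refine ⟨hΓW', codisjoint_iff.2 (eq_of_le_of_finrank_le le_top ?_)⟩
    rw [finrank_sup_of_disjoint hΓW', ← hWd, ← finrank_sup_of_disjoint hΓW, ht]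
  refine ⟨Γ, hΓ, hΓ', ?_⟩
  have h1 := finrank_sup_of_disjoint hSE
  have h2 := finrank_sup_of_disjoint hS'E
  rw [hS] at h1
  rw [hS'] at h2
  have h3 : finrank K S ≤ finrank K ↥(Γ ⊓ U) := finrank_mono (le_inf (le_sup_left.trans hle) hSU)
  have h4 : finrank K S' ≤ finrank K ↥(Γ ⊓ U') :=
    finrank_mono (le_inf (le_sup_right.trans hle) hS'U')
  omega

theorem finrank_inf_add_le {Γ : Submodule K V} (hΓ' : Disjoint Γ W') :
    finrank K ↥(Γ ⊓ U) + finrank K ↥(U ⊓ W') ≤ finrank K U := by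
  rw [← finrank_sup_of_disjoint (hΓ'.mono inf_le_left inf_le_right)]
  exact finrank_mono (sup_le inf_le_right inf_le_left)

/-- Given two decompositions `V = U ⊕ W = U' ⊕ W'` with `dim U = dim U'`, there is a common
complement of `W` and `W'` that meets `U` and `U'` in subspaces of the largest possible
total dimension. -/
theorem exists_commonComplement (h : IsCompl U W) (h' : IsCompl U' W')
    (hd : finrank K U = finrank K U') :
    ∃ Γ, IsCompl Γ W ∧ IsCompl Γ W' ∧
      finrank K ↥(Γ ⊓ U) + finrank K ↥(Γ ⊓ U') =
        min (finrank K U + finrank K ↥(U ⊓ U'))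
          (2 * finrank K U - (finrank K ↥(U ⊓ W') + finrank K ↥(U' ⊓ W))) := by
  have upper : ∀ Γ, IsCompl Γ W → IsCompl Γ W' →
      finrank K ↥(Γ ⊓ U) + finrank K ↥(Γ ⊓ U') ≤ finrank K U + finrank K ↥(U ⊓ U') ∧
      finrank K ↥(Γ ⊓ U) + finrank K ↥(Γ ⊓ U') +
        (finrank K ↥(U ⊓ W') + finrank K ↥(U' ⊓ W)) ≤ 2 * finrank K U := by
    intro Γ hΓ hΓ'
    have h1 := finrank_inf_add_le (U := U) hΓ'.disjoint
    have h2 := finrank_inf_add_le (U := U') hΓ.disjoint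
    have h3 := finrank_sup_add_finrank_inf_eq (Γ ⊓ U) (Γ ⊓ U')
    have h4 : finrank K ↥(Γ ⊓ U ⊔ Γ ⊓ U') ≤ finrank K Γ :=
      finrank_mono (sup_le inf_le_left inf_le_left)
    have h5 : finrank K ↥(Γ ⊓ U ⊓ (Γ ⊓ U')) ≤ finrank K ↥(U ⊓ U') :=
      finrank_mono (inf_le_inf inf_le_right inf_le_right)
    have h6 := finrank_add_eq_of_isCompl h
    have h7 := finrank_add_eq_of_isCompl hΓ
    omega
  -- The comparison decides which term of the minimum is the smaller one.
  rcases le_total (finrank K ↥(U ⊓ W') + finrank K ↥(U' ⊓ W) + finrank K ↥(U ⊓ U'))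
    (finrank K U) with hle | hle
  · obtain ⟨Γ, hΓ, hΓ', hdim⟩ := exists_commonComplement_of_le h h' hd hle
    exact ⟨Γ, hΓ, hΓ', by have := upper Γ hΓ hΓ'; omega⟩
  · obtain ⟨Γ, hΓ, hΓ', hdim⟩ := exists_commonComplement_of_ge h h' hd hle
    exact ⟨Γ, hΓ, hΓ', by have := upper Γ hΓ hΓ'; omega⟩

end CommonComplement

/-! ### Shears of the line number as switching networks. -/

section Networks

variable {m n : ℕ}

namespace SwitchingNetwork

theorem perm_append (N N' : SwitchingNetwork m n) (c : Fin (2 ^ m)) :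
    perm (N ++ N') c = perm N' c * perm N c := by
  induction N with
  | nil => simp [perm]
  | cons X N ih => simp [perm, ih, mul_assoc]

theorem switchCount_append (N N' : SwitchingNetwork m n) :
    switchCount (N ++ N') = switchCount N + switchCount N' := by
  simp [switchCount]

/-- Switches on the pairs of lines `{q, τ q}`, one for each `q` in a list. -/
def pairSwitches (τ : Fin (2 ^ n) → Fin (2 ^ n)) (hτ : ∀ q, q ≠ τ q)
    (control : Fin (2 ^ m) → Bool) (l : List (Fin (2 ^ n))) : SwitchingNetwork m n :=
  l.map fun q => Component.switch q (τ q) (hτ q) control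

theorem switchCount_pairSwitches (τ : Fin (2 ^ n) → Fin (2 ^ n)) (hτ : ∀ q, q ≠ τ q)
    (control : Fin (2 ^ m) → Bool) (l : List (Fin (2 ^ n))) :
    switchCount (pairSwitches τ hτ control l) = l.length := by
  simp [switchCount, pairSwitches, Function.comp_def, Component.switchCount]

/-- The pairs are disjoint, so each line meets at most one switch and the order of the list does not
matter. -/
theorem perm_pairSwitches (τ : Fin (2 ^ n) → Fin (2 ^ n)) (hτ : ∀ q, q ≠ τ q)
    (hinv : ∀ q, τ (τ q) = q) (control : Fin (2 ^ m) → Bool) (l : List (Fin (2 ^ n)))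
    (hl : l.Nodup) (hlτ : ∀ q ∈ l, τ q ∉ l) (c : Fin (2 ^ m)) (x : Fin (2 ^ n)) :
    perm (pairSwitches τ hτ control l) c x =
      if control c = true ∧ (x ∈ l ∨ τ x ∈ l) then τ x else x := by
  induction l generalizing x with
  | nil => simp [pairSwitches, perm]
  | cons a l ih =>
    obtain ⟨hal, hl⟩ := List.nodup_cons.1 hl
    have hτa : τ a ∉ l := fun h => hlτ a (by simp) (by simp [h])
    have ih := ih hl fun q hq h => hlτ q (by simp [hq]) (by simp [h])
    change perm (pairSwitches τ hτ control l) c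
      ((if control c = true then Equiv.swap a (τ a) else 1) x) = _
    by_cases hc : control c = true
    · rw [if_pos hc, ih]
      by_cases hxa : x = a
      · subst hxa
        simp [hc, hinv, hal, hτa]
      · by_cases hxb : x = τ a
        · subst hxb
          simp [hc, hinv, hal, hτa]
        · have hxb' : τ x ≠ a := fun h => hxb (by rw [← h, hinv])
          rw [Equiv.swap_apply_of_ne_of_ne hxa hxb]
          simp [hxa, hxb']
    · rw [if_neg hc, Equiv.Perm.one_apply, ih]
      simp [hc]

/-- The translation of the line numbers, viewed as digit vectors, by `u`. -/
def translate (u : Fin n → ZMod 2) (q : Fin (2 ^ n)) : Fin (2 ^ n) :=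
  (bitVec n).symm (bitVec n q + u)

theorem bitVec_translate (u : Fin n → ZMod 2) (q : Fin (2 ^ n)) :
    bitVec n (translate u q) = bitVec n q + u := by
  simp [translate]

theorem translate_translate (u : Fin n → ZMod 2) (q : Fin (2 ^ n)) :
    translate u (translate u q) = q := by
  apply (bitVec n).injective
  rw [bitVec_translate, bitVec_translate, add_assoc]
  exact add_eq_left.2 (funext fun j => CharTwo.add_self_eq_zero (u j))

theorem ne_translate {u : Fin n → ZMod 2} (hu : u ≠ 0) (q : Fin (2 ^ n)) : q ≠ translate u q := by
  intro h
  have := congrArg (bitVec n) h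
  rw [bitVec_translate] at this
  exact hu (left_eq_add.1 this)

theorem zmod_two_eq_one_of_ne_zero {a : ZMod 2} (h : a ≠ 0) : a = 1 := by
  revert a; decide

theorem card_bitVec_eq_zero (j : Fin n) :
    (Finset.univ.filter fun q : Fin (2 ^ n) => bitVec n q j = 0).card = 2 ^ (n - 1) := by
  have hsum := Finset.card_filter_add_card_filter_not (s := Finset.univ)
    fun q : Fin (2 ^ n) => bitVec n q j = 0
  have hnot : (Finset.univ.filter fun q : Fin (2 ^ n) => ¬ bitVec n q j = 0).card =
      (Finset.univ.filter fun q : Fin (2 ^ n) => bitVec n q j = 0).card := by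
    refine Finset.card_nbij' (translate (Pi.single j 1)) (translate (Pi.single j 1)) ?_ ?_
      (fun q _ => translate_translate _ q) (fun q _ => translate_translate _ q)
    · intro q hq
      have h1 := zmod_two_eq_one_of_ne_zero (Finset.mem_filter.1 hq).2
      simp [bitVec_translate, h1, CharTwo.add_self_eq_zero]
    · intro q hq
      have h1 : bitVec n q j = 0 := (Finset.mem_filter.1 hq).2
      simp [bitVec_translate, h1]
  rw [hnot, Finset.card_univ, Fintype.card_fin] at hsum
  have hpow : 2 ^ n = 2 * 2 ^ (n - 1) := (mul_pow_sub_one (by have := j.2; omega) 2).symm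
  omega

/-- A conditional translation of the lines by a nonzero vector takes `2 ^ (n - 1)` switches. -/
theorem exists_perm_eq_add_smul {u : Fin n → ZMod 2} (hu : u ≠ 0) (f : Fin (2 ^ m) → ZMod 2) :
    ∃ N : SwitchingNetwork m n, switchCount N = 2 ^ (n - 1) ∧
      ∀ c q, bitVec n (perm N c q) = bitVec n q + f c • u := by
  obtain ⟨j, hj⟩ := Function.ne_iff.1 hu
  have hj : u j = 1 := zmod_two_eq_one_of_ne_zero hj
  -- Translation by u flips digit j, so R contains exactly one line of each pair {q, q + u}.
  let R := Finset.univ.filter fun q : Fin (2 ^ n) => bitVec n q j = 0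
  have hR : ∀ q, q ∈ R ↔ bitVec n q j = 0 := by simp [R]
  have hRτ : ∀ q, translate u q ∈ R ↔ ¬ q ∈ R := by
    intro q
    rw [hR, hR, bitVec_translate, Pi.add_apply, hj]
    generalize bitVec n q j = a
    revert a; decide
  refine ⟨pairSwitches (translate u) (ne_translate hu) (fun c => decide (f c = 1)) R.toList,
    ?_, fun c q => ?_⟩
  · rw [switchCount_pairSwitches, Finset.length_toList, card_bitVec_eq_zero]
  · rw [perm_pairSwitches _ _ (translate_translate u) _ _ R.nodup_toList
      (fun q hq => by rw [Finset.mem_toList] at hq ⊢; rw [hRτ]; exact not_not.2 hq)]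
    simp only [Finset.mem_toList, hRτ, em, and_true, decide_eq_true_eq]
    split_ifs with h
    · rw [bitVec_translate, h, one_smul]
    · have : f c = 0 := by_contra fun h0 => h (zmod_two_eq_one_of_ne_zero h0)
      rw [this, zero_smul, add_zero]

theorem exists_perm_eq_add_sum (k : ℕ) (u : Fin k → Fin n → ZMod 2) (hu : ∀ i, u i ≠ 0)
    (f : Fin k → Fin (2 ^ m) → ZMod 2) :
    ∃ N : SwitchingNetwork m n, switchCount N = k * 2 ^ (n - 1) ∧
      ∀ c q, bitVec n (perm N c q) = bitVec n q + ∑ i, f i c • u i := by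
  induction k with
  | zero => exact ⟨[], by simp [switchCount], by simp [perm]⟩
  | succ k ih =>
    obtain ⟨N, hN, hNp⟩ := ih (fun i => u i.succ) (fun i => hu i.succ) fun i => f i.succ
    obtain ⟨N₀, hN₀, hN₀p⟩ := exists_perm_eq_add_smul (hu 0) (f 0)
    refine ⟨N₀ ++ N, by rw [switchCount_append, hN, hN₀]; ring, fun c q => ?_⟩
    rw [perm_append, Equiv.Perm.mul_apply, hNp, hN₀p, Fin.sum_univ_succ, add_assoc]

end SwitchingNetwork

/-- A linear map is the sum of as many maps of rank one as its rank says. -/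
theorem exists_eq_sum_smul {K E F : Type*} [Field K] [AddCommGroup E] [Module K E]
    [AddCommGroup F] [Module K F] [FiniteDimensional K F] (L : E →ₗ[K] F) :
    ∃ (u : Fin (Module.finrank K L.range) → F) (φ : Fin (Module.finrank K L.range) → E →ₗ[K] K),
      (∀ i, u i ≠ 0) ∧ ∀ x, L x = ∑ i, φ i x • u i := by
  let b := Module.finBasis K L.range
  refine ⟨fun i => b i, fun i => b.coord i ∘ₗ L.rangeRestrict, fun i h => b.ne_zero i ?_,
    fun x => ?_⟩
  · exact Subtype.ext h
  · have h := congrArg L.range.subtype (b.sum_repr (L.rangeRestrict x))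
    rw [map_sum] at h
    exact h.symm

/-- Adding to the line number a linear function of the cycle takes `2 ^ (n - 1)` switches for
each unit of rank. -/
theorem SwitchingNetwork.exists_perm_eq_add_linearMap
    (L : (Fin m → ZMod 2) →ₗ[ZMod 2] (Fin n → ZMod 2)) :
    ∃ N : SwitchingNetwork m n,
      switchCount N = Module.finrank (ZMod 2) L.range * 2 ^ (n - 1) ∧
      ∀ c q, bitVec n (perm N c q) = bitVec n q + L (bitVec m c) := by
  obtain ⟨u, φ, hu, hL⟩ := exists_eq_sum_smul L
  obtain ⟨N, hN, hNp⟩ := exists_perm_eq_add_sum (m := m) _ u hu fun i c => φ i (bitVec m c)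
  exact ⟨N, hN, fun c q => by rw [hNp, hL]⟩

end Networks

/-! ### Permuting cycles separately on each line with double-buffered banks. -/

section Banks

variable {m n : ℕ}

theorem counter_eq_counter_iff {k t t' : ℕ} : counter k t = counter k t' ↔ t ≡ t' [MOD 2 ^ k] := by
  simp [counter, Nat.ModEq]

/-- The array whose banks each write their words in the order of arrival, and where bank `p`
outputs in cycle `ρ p c` of a dataset the word that arrived in cycle `c`. -/
def RAMBankArray.ofPerm (ρ : Fin (2 ^ n) → Equiv.Perm (Fin (2 ^ m))) : RAMBankArray m n where
  writeAddr _ τ := τ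
  -- The outgoing dataset is read one dataset length after its arrival, which began 2^m cycles
  -- before τ - c', with c' the current cycle in the dataset. Modulo 2^(m+1), subtracting 2^m is
  -- adding it, hence the term 2^m - c'.
  readAddr p τ := counter (m + 1)
    ((τ : ℕ) + (2 ^ m - (counter m τ : ℕ)) + ((ρ p).symm (counter m τ) : ℕ))

namespace RAMBankArray

variable {α : Type} (ρ : Fin (2 ^ n) → Equiv.Perm (Fin (2 ^ m)))
  (init : Fin (2 ^ n) → Fin (2 ^ (m + 1)) → α) (s : Stream n α) (p : Fin (2 ^ n))

/-- A word survives until its address recurs, 2^(m+1) cycles later. Equality is allowed in `h'`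
because `contents` describes the state before the write of cycle t. -/
theorem contents_ofPerm {t t' : ℕ} (h : t' < t) (h' : t ≤ t' + 2 ^ (m + 1)) :
    (ofPerm ρ).contents init s p t (counter (m + 1) t') = s t' p := by
  induction t with
  | zero => omega
  | succ t ih =>
    change Function.update _ (counter (m + 1) t) _ _ = _
    by_cases htt' : t = t'
    · subst htt'
      simp
    · rw [Function.update_of_ne, ih (by omega) (by omega)]
      rw [Ne, counter_eq_counter_iff]
      intro hmod
      have := Nat.le_of_dvd (by omega) ((Nat.modEq_iff_dvd' (by omega)).1 hmod)
      omega

theorem run_ofPerm (d : ℕ) (c : Fin (2 ^ m)) :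
    (ofPerm ρ).run init s (2 ^ m + d * 2 ^ m + (ρ p c : ℕ)) p = s (d * 2 ^ m + c) p := by
  have hc := c.2
  have hc' := (ρ p c).2
  have hcount : counter m (counter (m + 1) (2 ^ m + d * 2 ^ m + (ρ p c : ℕ)) : ℕ) = ρ p c := by
    apply Fin.ext
    have h1 : 2 ^ m + d * 2 ^ m + (ρ p c : ℕ) = (ρ p c : ℕ) + 2 ^ m * (d + 1) := by ring
    simp only [counter]
    rw [Nat.mod_mod_of_dvd _ (pow_dvd_pow 2 (Nat.le_succ m)), h1, Nat.add_mul_mod_self_left,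
      Nat.mod_eq_of_lt hc']
  have haddr : (ofPerm ρ).readAddr p (counter (m + 1) (2 ^ m + d * 2 ^ m + (ρ p c : ℕ))) =
      counter (m + 1) (d * 2 ^ m + c) := by
    simp only [ofPerm]
    rw [hcount, Equiv.symm_apply_apply, counter_eq_counter_iff]
    have h1 : (counter (m + 1) (2 ^ m + d * 2 ^ m + (ρ p c : ℕ)) : ℕ) ≡
        2 ^ m + d * 2 ^ m + (ρ p c : ℕ) [MOD 2 ^ (m + 1)] := Nat.mod_modEq _ _
    have h2 : 2 ^ m + d * 2 ^ m + (ρ p c : ℕ) + (2 ^ m - (ρ p c : ℕ)) + (c : ℕ) =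
        d * 2 ^ m + c + 2 ^ (m + 1) := by
      rw [pow_succ]
      omega
    refine ((h1.add_right _).add_right _).trans ?_
    rw [h2]
    exact Nat.add_modEq_right
  unfold run
  rw [haddr]
  refine contents_ofPerm ρ init s p ?_ ?_
  · omega
  · rw [pow_succ]
    omega

end RAMBankArray

end Banks

/-! ### From common complements to a factorization of T. -/

section Factorization

open Module Submodule

variable {K E F : Type*} [Field K] [AddCommGroup E] [Module K E] [FiniteDimensional K E]
  [AddCommGroup F] [Module K F] [FiniteDimensional K F]

/-- Rank–nullity with the kernel embedded in V; it converts ranks of blocks and shears into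
dimensions of intersections. -/
theorem finrank_range_add_finrank_of_mem_iff {E' F' V : Type*} [AddCommGroup E'] [Module K E']
    [FiniteDimensional K E'] [AddCommGroup F'] [Module K F'] [AddCommGroup V] [Module K V]
    (f : E' →ₗ[K] F') (ι : E' →ₗ[K] V) (hι : Function.Injective ι) (M : Submodule K V)
    (hM : ∀ x, x ∈ M ↔ ∃ y, f y = 0 ∧ ι y = x) :
    finrank K f.range + finrank K M = finrank K E' := by
  have : M = f.ker.map ι := by
    ext x
    simp [hM]
  rw [this, ← (Submodule.equivMapOfInjective ι hι f.ker).finrank_eq]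
  exact f.finrank_range_add_finrank_ker

/-- An automorphism `T` of `E × F` is a shear `p ↦ p - X c`, followed by a map that does not
change the second component, followed by an automorphism of `F` and a shear `p ↦ p + L c`.
The ranks of the two shears can be chosen to add up to the least value possible. -/
theorem exists_factorization (T : (E × F) ≃ₗ[K] (E × F)) :
    ∃ (X L : E →ₗ[K] F) (A : E ≃ₗ[K] E) (B : F →ₗ[K] E) (D : F ≃ₗ[K] F),
      (∀ c p, T (c, p + X c) = (A c + B p, D p + L (A c + B p))) ∧
      finrank K X.range + finrank K L.range =
        max (finrank K (LinearMap.snd K E F ∘ₗ T.toLinearMap ∘ₗ LinearMap.inl K E F).range)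
          (finrank K F + finrank K E -
            finrank K (LinearMap.snd K E F ∘ₗ T.toLinearMap ∘ₗ LinearMap.inr K E F).range -
            finrank K (LinearMap.fst K E F ∘ₗ T.toLinearMap ∘ₗ LinearMap.inl K E F).range) := by
  let U : Submodule K (E × F) := (LinearMap.inl K E F).range
  let W : Submodule K (E × F) := (LinearMap.inr K E F).range
  let U' : Submodule K (E × F) := U.map T.symm.toLinearMap
  let W' : Submodule K (E × F) := W.map T.symm.toLinearMap
  have mU : ∀ x, x ∈ U ↔ x.2 = 0 := fun x => by
    simp only [U, LinearMap.range_inl, LinearMap.mem_ker, LinearMap.snd_apply]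
  have mW : ∀ x, x ∈ W ↔ x.1 = 0 := fun x => by
    simp only [W, LinearMap.range_inr, LinearMap.mem_ker, LinearMap.fst_apply]
  have mU' : ∀ x, x ∈ U' ↔ (T x).2 = 0 := fun x => by
    rw [← mU]; exact Submodule.mem_map_equiv U (e := T.symm)
  have mW' : ∀ x, x ∈ W' ↔ (T x).1 = 0 := fun x => by
    rw [← mW]; exact Submodule.mem_map_equiv W (e := T.symm)
  have h : IsCompl U W := LinearMap.isCompl_range_inl_inr
  have h' : IsCompl U' W' := (Submodule.orderIsoMapComap T.symm).isCompl h
  have hd : finrank K U = finrank K U' := (LinearEquiv.finrank_map_eq T.symm U).symm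
  have hUd : finrank K U = finrank K E :=
    LinearMap.finrank_range_of_inj LinearMap.inl_injective
  obtain ⟨Γ, hΓ, hΓ', hdim⟩ := exists_commonComplement h h' hd
  have hbij : Function.Bijective (Prod.fst ∘ Γ.subtype) := by
    constructor
    · intro x y hxy
      have hmem : (x : E × F) - y ∈ W := (mW _).2 (sub_eq_zero.2 hxy)
      exact Subtype.ext (sub_eq_zero.1
        (disjoint_def.1 hΓ.disjoint _ (Γ.sub_mem x.2 y.2) hmem))
    · intro c
      have hc : (c, (0 : F)) ∈ Γ ⊔ W := by rw [hΓ.sup_eq_top]; trivial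
      obtain ⟨g, hg, w, hw, hgw⟩ := mem_sup.1 hc
      refine ⟨⟨g, hg⟩, ?_⟩
      have := congrArg Prod.fst hgw
      rwa [Prod.fst_add, (mW w).1 hw, add_zero] at this
  -- A complement of 0 × F is the graph of a linear map, and this map is the first shear.
  obtain ⟨X, rfl⟩ := Submodule.exists_eq_graph hbij
  let σ : E →ₗ[K] E × F := LinearMap.id.prod X
  have hσ : Function.Injective σ := fun c c' hc => congrArg Prod.fst hc
  have mΓ : ∀ x, x ∈ X.graph ↔ σ x.1 = x := fun x => by
    rw [LinearMap.mem_graph_iff]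
    exact ⟨fun hx => Prod.ext rfl hx.symm, fun hx => (congrArg Prod.snd hx).symm⟩
  let A₀ : E →ₗ[K] E := LinearMap.fst K E F ∘ₗ T.toLinearMap ∘ₗ σ
  have hA₀ : Function.Injective A₀ := by
    rw [← LinearMap.ker_eq_bot, LinearMap.ker_eq_bot']
    intro c hc
    have hz : σ c = 0 := disjoint_def.1 hΓ'.disjoint (σ c) ((mΓ _).2 rfl) ((mW' _).2 hc)
    exact congrArg Prod.fst hz
  let A : E ≃ₗ[K] E := LinearEquiv.ofInjectiveEndo A₀ hA₀
  have hA : ∀ c, A c = (T (σ c)).1 := fun c => rfl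
  let Y : E →ₗ[K] F := LinearMap.snd K E F ∘ₗ T.toLinearMap ∘ₗ σ
  -- T maps Γ to the graph of L. Injectivity of A came from Γ ∩ W' = 0.
  let L : E →ₗ[K] F := Y ∘ₗ A.symm.toLinearMap
  have hLA : ∀ c, L (A c) = (T (σ c)).2 := fun c => by
    change Y (A.symm (A c)) = _
    rw [A.symm_apply_apply]
    rfl
  let B : F →ₗ[K] E := LinearMap.fst K E F ∘ₗ T.toLinearMap ∘ₗ LinearMap.inr K E F
  -- The Schur complement of A in T after the shear X.
  let D₀ : F →ₗ[K] F := LinearMap.snd K E F ∘ₗ T.toLinearMap ∘ₗ LinearMap.inr K E F - L ∘ₗ B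
  have hT : ∀ c p, T (c, p + X c) = (A c + B p, D₀ p + L (A c + B p)) := by
    intro c p
    have hsplit : (c, p + X c) = σ c + (0, p) := Prod.ext (by simp [σ]) (by simp [σ, add_comm])
    rw [hsplit, map_add]
    refine Prod.ext rfl ?_
    rw [map_add L, hLA]
    change (T (σ c)).2 + (T (0, p)).2 = (T (0, p)).2 - L (B p) + ((T (σ c)).2 + L (B p))
    abel
  have hD₀ : Function.Injective D₀ := by
    rw [← LinearMap.ker_eq_bot, LinearMap.ker_eq_bot']
    intro p hp
    -- The first argument is chosen to cancel the E-component, so D₀ p = 0 yields a vector in the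
    -- kernel of T.
    have hz := hT (A.symm (-B p)) p
    rw [A.apply_symm_apply, hp, neg_add_cancel, map_zero, zero_add, ← Prod.zero_eq_mk,
      LinearEquiv.map_eq_zero_iff, Prod.mk_eq_zero] at hz
    obtain ⟨h1, h2⟩ := hz
    rwa [h1, map_zero, add_zero] at h2
  refine ⟨X, L, A, B, LinearEquiv.ofInjectiveEndo D₀ hD₀, hT, ?_⟩
  have hL : L.range = Y.range := LinearEquiv.range_comp A.symm Y
  rw [hL]
  have r1 := finrank_range_add_finrank_of_mem_iff X (LinearMap.inl K E F)
    LinearMap.inl_injective (X.graph ⊓ U) fun x => by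
      rw [mem_inf, mU, LinearMap.mem_graph_iff]
      constructor
      · rintro ⟨h1, h2⟩
        exact ⟨x.1, h1.symm.trans h2, Prod.ext rfl h2.symm⟩
      · rintro ⟨y, hy, rfl⟩
        exact ⟨hy.symm, rfl⟩
  have r2 := finrank_range_add_finrank_of_mem_iff Y σ hσ (X.graph ⊓ U') fun x => by
      rw [mem_inf, mU', mΓ]
      constructor
      · rintro ⟨h1, h2⟩
        refine ⟨x.1, ?_, h1⟩
        change (T (σ x.1)).2 = 0
        rwa [h1]
      · rintro ⟨y, hy, rfl⟩
        exact ⟨rfl, hy⟩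
  have r3 := finrank_range_add_finrank_of_mem_iff
    (LinearMap.snd K E F ∘ₗ T.toLinearMap ∘ₗ LinearMap.inl K E F) (LinearMap.inl K E F)
    LinearMap.inl_injective (U ⊓ U') fun x => by
      rw [mem_inf, mU']
      constructor
      · rintro ⟨⟨y, rfl⟩, h2⟩
        exact ⟨y, h2, rfl⟩
      · rintro ⟨y, hy, rfl⟩
        exact ⟨⟨y, rfl⟩, hy⟩
  have r4 := finrank_range_add_finrank_of_mem_iff
    (LinearMap.fst K E F ∘ₗ T.toLinearMap ∘ₗ LinearMap.inl K E F) (LinearMap.inl K E F)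
    LinearMap.inl_injective (U ⊓ W') fun x => by
      rw [mem_inf, mW']
      constructor
      · rintro ⟨⟨y, rfl⟩, h2⟩
        exact ⟨y, h2, rfl⟩
      · rintro ⟨y, hy, rfl⟩
        exact ⟨⟨y, rfl⟩, hy⟩
  have r5 := finrank_range_add_finrank_of_mem_iff
    (LinearMap.snd K E F ∘ₗ T.toLinearMap ∘ₗ LinearMap.inr K E F) (LinearMap.inr K E F)
    LinearMap.inr_injective (U' ⊓ W) fun x => by
      rw [mem_inf, mU']
      constructor
      · rintro ⟨h2, ⟨y, rfl⟩⟩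
        exact ⟨y, h2, rfl⟩
      · rintro ⟨y, hy, rfl⟩
        exact ⟨hy, ⟨y, rfl⟩⟩
  -- These bounds ensure that the truncated subtraction in `hdim` is a true one.
  have b1 := finrank_inf_add_le (U := U) hΓ'.disjoint
  have b2 := finrank_inf_add_le (U := U') hΓ.disjoint
  omega

end Factorization

/-! ### Digits of an index as digits of cycle and port. -/

section Digits

variable {m n : ℕ}

/-- The digit vector of an index split into the digits of its cycle and those of its port. -/
def splitDigits (m n : ℕ) (R : Type*) [Semiring R] :
    (Fin (m + n) → R) ≃ₗ[R] (Fin m → R) × (Fin n → R) where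
  toFun v := (fun j => v (Fin.castAdd n j), fun j => v (Fin.natAdd m j))
  invFun x := Fin.append x.1 x.2
  map_add' _ _ := rfl
  map_smul' _ _ := rfl
  left_inv _ := Fin.append_castAdd_natAdd
  right_inv x := by simp

/-- The cycle of an index, within its dataset. -/
def cycleIndex (i : Fin (2 ^ (m + n))) : Fin (2 ^ m) :=
  ⟨cycleOf i, Nat.div_lt_of_lt_mul (by rw [mul_comm, ← pow_add]; exact i.2)⟩

theorem splitDigits_bitVec (i : Fin (2 ^ (m + n))) :
    splitDigits m n (ZMod 2) (bitVec (m + n) i) =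
      (bitVec m (cycleIndex i), bitVec n (portOf i)) := by
  refine Prod.ext (funext fun j => ?_) (funext fun j => ?_)
  · change bitVec (m + n) i (Fin.castAdd n j) = bitVec m (cycleIndex i) j
    rw [bitVec_apply, bitVec_apply]
    have h : m + n - 1 - (Fin.castAdd n j : ℕ) = n + (m - 1 - (j : ℕ)) := by
      rw [Fin.val_castAdd]
      omega
    rw [h, pow_add 2 n (m - 1 - j), ← Nat.div_div_eq_div_mul]
    rfl
  · change bitVec (m + n) i (Fin.natAdd m j) = bitVec n (portOf i) j
    rw [bitVec_apply, bitVec_apply]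
    have h : m + n - 1 - (Fin.natAdd m j : ℕ) = n - 1 - (j : ℕ) := by
      rw [Fin.val_natAdd]
      omega
    rw [h, ZMod.natCast_eq_natCast_iff]
    change _ ≡ ((i : ℕ) % 2 ^ n) / _ [MOD 2]
    obtain ⟨k, hk⟩ : ∃ k, n = n - 1 - (j : ℕ) + 1 + k := ⟨j, by omega⟩
    generalize n - 1 - (j : ℕ) = e at hk
    -- Reducing i modulo 2^n changes the quotient by 2^e by an even number only, as e < n.
    have hi : (i : ℕ) = i % 2 ^ n + 2 ^ e * (2 * (2 ^ k * (i / 2 ^ n))) := by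
      conv_lhs => rw [← Nat.mod_add_div (i : ℕ) (2 ^ n)]
      conv_lhs => enter [2, 1]; rw [hk]
      ring
    conv_lhs => rw [hi]
    rw [Nat.add_mul_div_left _ _ (Nat.two_pow_pos e)]
    simp [Nat.ModEq]

theorem counter_add_cycleIndex (k : ℕ) (c : Fin (2 ^ m)) : counter m (k * 2 ^ m + c) = c := by
  apply Fin.ext
  simp only [counter]
  rw [mul_comm, Nat.mul_add_mod, Nat.mod_eq_of_lt c.2]

end Digits

/-! ### The circuit built from the factorization. -/

section Circuit

variable {m n : ℕ}

/-- Multiplication by `P` as an automorphism of the space of digit vectors. -/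
def mulVecEquiv {k : ℕ} (P : GL (Fin k) (ZMod 2)) :
    (Fin k → ZMod 2) ≃ₗ[ZMod 2] (Fin k → ZMod 2) where
  __ := mulVecPerm P
  map_add' := Matrix.mulVec_add _
  map_smul' a v := Matrix.mulVec_smul _ a v

/-- Multiplication by `P` on pairs of a cycle and a port. -/
def blockEquiv (P : GL (Fin (m + n)) (ZMod 2)) :
    ((Fin m → ZMod 2) × (Fin n → ZMod 2)) ≃ₗ[ZMod 2] ((Fin m → ZMod 2) × (Fin n → ZMod 2)) :=
  (splitDigits m n (ZMod 2)).symm ≪≫ₗ mulVecEquiv P ≪≫ₗ splitDigits m n (ZMod 2)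

theorem blockEquiv_apply (P : GL (Fin (m + n)) (ZMod 2)) (i : Fin (2 ^ (m + n))) :
    blockEquiv P (bitVec m (cycleIndex i), bitVec n (portOf i)) =
      (bitVec m (cycleIndex (linearPerm P i)), bitVec n (portOf (linearPerm P i))) := by
  rw [← splitDigits_bitVec, ← splitDigits_bitVec, bitVec_linearPerm, blockEquiv,
    LinearEquiv.trans_apply, LinearEquiv.trans_apply, LinearEquiv.symm_apply_apply]
  rfl

theorem snd_comp_blockEquiv_comp_inl (P : GL (Fin (m + n)) (ZMod 2)) :
    LinearMap.snd (ZMod 2) _ _ ∘ₗ (blockEquiv P).toLinearMap ∘ₗ LinearMap.inl (ZMod 2) _ _ =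
      (block₂ P).mulVecLin := by
  ext v j
  simp [blockEquiv, splitDigits, mulVecEquiv, mulVecPerm, block₂, Matrix.mulVec, dotProduct,
    Fin.sum_univ_add]

theorem fst_comp_blockEquiv_comp_inl (P : GL (Fin (m + n)) (ZMod 2)) :
    LinearMap.fst (ZMod 2) _ _ ∘ₗ (blockEquiv P).toLinearMap ∘ₗ LinearMap.inl (ZMod 2) _ _ =
      (block₄ P).mulVecLin := by
  ext v j
  simp [blockEquiv, splitDigits, mulVecEquiv, mulVecPerm, block₄, Matrix.mulVec, dotProduct,
    Fin.sum_univ_add]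

theorem snd_comp_blockEquiv_comp_inr (P : GL (Fin (m + n)) (ZMod 2)) :
    LinearMap.snd (ZMod 2) _ _ ∘ₗ (blockEquiv P).toLinearMap ∘ₗ LinearMap.inr (ZMod 2) _ _ =
      (block₁ P).mulVecLin := by
  ext v j
  simp [blockEquiv, splitDigits, mulVecEquiv, mulVecPerm, block₁, Matrix.mulVec, dotProduct,
    Fin.sum_univ_add]

/-- A circuit implements a permutation if the line and cycle of every word agree. -/
theorem FramedCircuit.implements_of_forall (N N' : SwitchingNetwork m n)
    (ρ : Fin (2 ^ n) → Equiv.Perm (Fin (2 ^ m))) (σ : Equiv.Perm (Fin (2 ^ (m + n))))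
    (hcycle : ∀ i, ρ (N.perm (cycleIndex i) (portOf i)) (cycleIndex i) = cycleIndex (σ i))
    (hport : ∀ i, N'.perm (cycleIndex (σ i)) (N.perm (cycleIndex i) (portOf i)) = portOf (σ i)) :
    FramedCircuit.Implements ⟨N, RAMBankArray.ofPerm ρ, N'⟩ σ := by
  -- With one dataset length as latency, the counter of the output network shows the cycle within
  -- the outgoing dataset.
  refine ⟨2 ^ m, fun α init s d i => ?_⟩
  have hc : counter m (2 ^ m + d * 2 ^ m + cycleOf (σ i)) = cycleIndex (σ i) := by
    rw [← one_add_mul (d : ℕ) (2 ^ m)]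
    exact counter_add_cycleIndex _ (cycleIndex (σ i))
  have hc' : counter m (d * 2 ^ m + cycleOf i) = cycleIndex i :=
    counter_add_cycleIndex d (cycleIndex i)
  have hq : (N'.perm (cycleIndex (σ i))).symm (portOf (σ i)) =
      N.perm (cycleIndex i) (portOf i) := by
    rw [← hport, Equiv.symm_apply_apply]
  have hrun := RAMBankArray.run_ofPerm ρ init (SwitchingNetwork.run N s)
    (N.perm (cycleIndex i) (portOf i)) d (cycleIndex i)
  rw [hcycle] at hrun
  change (RAMBankArray.ofPerm ρ).run init (SwitchingNetwork.run N s)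
    (2 ^ m + d * 2 ^ m + cycleOf (σ i))
    ((N'.perm (counter m (2 ^ m + d * 2 ^ m + cycleOf (σ i)))).symm (portOf (σ i))) = _
  rw [hc, hq]
  refine hrun.trans ?_
  change s (d * 2 ^ m + cycleOf i) ((N.perm (counter m (d * 2 ^ m + cycleOf i))).symm
    (N.perm (cycleIndex i) (portOf i))) = _
  rw [hc', Equiv.symm_apply_apply]

end Circuit

end SLP

theorem mainTheorem4 (m n : ℕ) (P : GL (Fin (m + n)) (ZMod 2)) :
    ∃ C : SLP.FramedCircuit m n,
      C.Implements (SLP.linearPerm P) ∧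
      C.switchCount =
        max (SLP.block₂ P).rank (n + m - (SLP.block₁ P).rank - (SLP.block₄ P).rank) *
          2 ^ (n - 1) := by
  obtain ⟨X, L, A, B, D, hT, hrank⟩ := SLP.exists_factorization (SLP.blockEquiv P)
  obtain ⟨N, hN, hNp⟩ := SLP.SwitchingNetwork.exists_perm_eq_add_linearMap X
  obtain ⟨N', hN', hNp'⟩ := SLP.SwitchingNetwork.exists_perm_eq_add_linearMap L
  let δ : Equiv.Perm (Fin (2 ^ n)) := (SLP.bitVec n).trans (D.toEquiv.trans (SLP.bitVec n).symm)
  have hδ : ∀ q, SLP.bitVec n (δ q) = D (SLP.bitVec n q) := fun q => by simp [δ]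
  -- On a fixed line q the cycle undergoes the affine bijection c ↦ A c + B q.
  let ρ : Fin (2 ^ n) → Equiv.Perm (Fin (2 ^ m)) := fun q => (SLP.bitVec m).trans
    (A.toEquiv.trans ((Equiv.addRight (B (SLP.bitVec n q))).trans (SLP.bitVec m).symm))
  have hρ : ∀ q c, SLP.bitVec m (ρ q c) = A (SLP.bitVec m c) + B (SLP.bitVec n q) :=
    fun q c => by simp [ρ]
  have key : ∀ i : Fin (2 ^ (m + n)),
      (SLP.bitVec m (SLP.cycleIndex (SLP.linearPerm P i)) =
        A (SLP.bitVec m (SLP.cycleIndex i)) +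
          B (SLP.bitVec n (N.perm (SLP.cycleIndex i) (SLP.portOf i)))) ∧
      SLP.bitVec n (SLP.portOf (SLP.linearPerm P i)) =
        D (SLP.bitVec n (N.perm (SLP.cycleIndex i) (SLP.portOf i))) +
          L (SLP.bitVec m (SLP.cycleIndex (SLP.linearPerm P i))) := by
    intro i
    have h := SLP.blockEquiv_apply P i
    -- The factorization needs the shear p ↦ p - X c; in characteristic 2 the network that adds X c
    -- performs it.
    have hp : SLP.bitVec n (SLP.portOf i) =
        SLP.bitVec n (N.perm (SLP.cycleIndex i) (SLP.portOf i)) +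
          X (SLP.bitVec m (SLP.cycleIndex i)) := by
      rw [hNp, add_assoc]
      exact (add_eq_left.2 (funext fun j => CharTwo.add_self_eq_zero _)).symm
    rw [hp, hT, Prod.mk.injEq] at h
    exact ⟨h.1.symm, by rw [← h.1]; exact h.2.symm⟩
  refine ⟨⟨N, SLP.RAMBankArray.ofPerm ρ, .wiring δ :: N'⟩,
    SLP.FramedCircuit.implements_of_forall _ _ _ _ (fun i => ?_) (fun i => ?_), ?_⟩
  · apply (SLP.bitVec m).injective
    rw [hρ, (key i).1]
  · apply (SLP.bitVec n).injective
    change SLP.bitVec n (SLP.SwitchingNetwork.perm N' _ (δ _)) = _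
    rw [hNp', hδ, (key i).2]
  · have hcount : SLP.SwitchingNetwork.switchCount (.wiring δ :: N') =
        SLP.SwitchingNetwork.switchCount N' := by
      simp [SLP.SwitchingNetwork.switchCount, SLP.Component.switchCount]
    rw [SLP.snd_comp_blockEquiv_comp_inl, SLP.fst_comp_blockEquiv_comp_inl,
      SLP.snd_comp_blockEquiv_comp_inr, Module.finrank_fin_fun, Module.finrank_fin_fun] at hrank
    rw [SLP.FramedCircuit.switchCount, hcount, hN, hN', ← add_mul, hrank]
    rfl
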